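/- Let $1\le p,q<\infty$ with $p\neq q$ and $p/q\in\mathbb N$. Then the real Banach lattice $L_p(L_q)=L_p([0,1];L_q[0,1])$ (Lebesgue measure on $[0,1]$, almost everywhere pointwise order) is not approximately ultrahomogeneous (AUH) over the class of its finite-dimensional sublattices. Here a Banach lattice $X$ is called AUH over a class $\mathcal G$ of its sublattices if for every $E\in\mathcal G$, every finite tuple $e_1,\dots,e_n\in E$ generating $E$ as a Banach lattice, all isometric linear lattice embeddings $f_1,f_2:E\to X$ and every $\varepsilon>0$, there is a surjective linear isometric lattice automorphism $\phi:X\to X$ with $\|\phi(f_1(e_j))-f_2(e_j)\|<\varepsilon$ for all $1\le j\le n$. -/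

import Mathlib

open MeasureTheory
open scoped ENNReal

/-- Lebesgue measure on the unit interval `[0,1]`. -/
noncomputable abbrev unitMeasure : Measure ℝ := volume.restrict (Set.Icc (0 : ℝ) 1)

/-- The Banach lattice `L_p(L_q) = L_p([0,1]; L_q[0,1])` of (classes of) strongly measurable,
`p`-integrable functions with values in `L_q[0,1]`, with its norm and its almost everywhere
pointwise order (the values being compared in the almost everywhere order of `L_q[0,1]`). -/
abbrev LpLq (p q : ℝ≥0∞) [Fact (1 ≤ q)] : Type :=
  Lp (Lp ℝ q unitMeasure) p unitMeasure

/-- A (vector) sublattice of `X`: a linear subspace that is closed under `⊔` and `⊓`. -/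
structure VectorSublattice (X : Type*) [NormedAddCommGroup X] [Lattice X] [NormedSpace ℝ X]
    extends Submodule ℝ X where
  sup_mem' : ∀ {x y : X}, x ∈ carrier → y ∈ carrier → x ⊔ y ∈ carrier
  inf_mem' : ∀ {x y : X}, x ∈ carrier → y ∈ carrier → x ⊓ y ∈ carrier

/-- A sublattice with the lattice operations (and order) inherited from `X`. -/
instance VectorSublattice.instLattice {X : Type*} [NormedAddCommGroup X] [Lattice X]
    [NormedSpace ℝ X] (E : VectorSublattice X) : Lattice E.toSubmodule :=
  Subtype.lattice (fun _ _ => E.sup_mem') (fun _ _ => E.inf_mem')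

/-- `E` is the Banach lattice generated by `e 1, …, e n`: the smallest closed vector sublattice
of `X` that contains these elements. -/
def VectorSublattice.IsGeneratedBy {X : Type*} [NormedAddCommGroup X] [Lattice X]
    [NormedSpace ℝ X] (E : VectorSublattice X) {n : ℕ} (e : Fin n → E.toSubmodule) : Prop :=
  IsClosed (E.toSubmodule : Set X) ∧
    ∀ F : VectorSublattice X, IsClosed (F.toSubmodule : Set X) →
      (∀ j, (e j : X) ∈ F.toSubmodule) → E.toSubmodule ≤ F.toSubmodule

/-- `f` preserves the lattice operations. -/
def PreservesLattice {X Y : Type*} [Lattice X] [Lattice Y] (f : X → Y) : Prop :=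
  ∀ x y : X, f (x ⊔ y) = f x ⊔ f y ∧ f (x ⊓ y) = f x ⊓ f y

/-- `X` is approximately ultrahomogeneous over a class `𝒢` of its sublattices: for all `E ∈ 𝒢`
generated by `e 1, …, e n`, all isometric lattice embeddings `f₁, f₂ : E → X` and all `ε > 0`,
there is an isometric lattice automorphism `φ` of `X` such that
`‖φ (f₁ (e j)) - f₂ (e j)‖ < ε` for every `j`. -/
def IsAUHOver (X : Type*) [NormedAddCommGroup X] [Lattice X] [NormedSpace ℝ X]
    (𝒢 : Set (VectorSublattice X)) : Prop :=
  ∀ E ∈ 𝒢, ∀ (n : ℕ) (e : Fin n → E.toSubmodule), E.IsGeneratedBy e →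
    ∀ f₁ f₂ : E.toSubmodule →ₗᵢ[ℝ] X, PreservesLattice f₁ → PreservesLattice f₂ →
      ∀ ε : ℝ, 0 < ε →
        ∃ φ : X ≃ₗᵢ[ℝ] X, PreservesLattice φ ∧ ∀ j, ‖φ (f₁ (e j)) - f₂ (e j)‖ < ε

/-! Write `p = n q` with `n ≥ 2`. For disjoint positive unit vectors `w₁, w₂` of `L_q` and `h ≥ 0`,
put `x = 1 ⊗ w₁` and `y = h^(1/q) ⊗ w₂`. Then `‖a x + b y‖^p = ∫ (|a|^q + |b|^q h)^n`, so the span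
of `x, y` sees only the moments of `h` up to order `n`. `exists_equal_moments` gives `h` and `k`
that share these moments, while `h` vanishes on a set `A` of positive measure and `k ≥ 1`. With `y'
= k^(1/q) ⊗ w₂`, the maps `x, y ↦ x, y` and `x, y ↦ x, y'` are isometric lattice embeddings of one
plane.

No lattice isometry `φ` nearly carries one to the other. Disjoint elements have disjoint outer
supports exactly when their norm is `p`-additive (`Lp_Lp_ae_eq_zero_or_of_norm_add_rpow`), so `φ`
preserves outer disjointness. The piece `c = 1_A ⊗ w₁` of `x` lives off the outer support of `y`,
whereas `y'` dominates `x` in fibre norm everywhere. Hence `φ c` must be small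
(`norm_le_of_preservesLattice`), although `‖φ c‖ = ‖c‖ > 0`. -/

/-! ### Two laws with equal moments up to order `n`. -/

/-- Every finitely supported probability distribution on the natural numbers is the law of a
measurable function on `[0,1]`. -/
theorem exists_measurable_map_unitMeasure_eq (s : Finset ℕ) (w : ℕ → ℝ≥0∞)
    (hw : ∑ j ∈ s, w j = 1) :
    ∃ h : ℝ → ℝ, Measurable h ∧
      unitMeasure.map h = ∑ j ∈ s, w j • Measure.dirac (j : ℝ) := by
  have : IsProbabilityMeasure (∑ j ∈ s, w j • Measure.dirac (j : ℝ)) := ⟨by simp [hw]⟩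
  obtain ⟨f, hf, hfm⟩ := Measure.exists_measurable_map_eq (∑ j ∈ s, w j • Measure.dirac (j : ℝ))
  have hm : Measurable (Set.projIcc (0 : ℝ) 1 zero_le_one) := continuous_projIcc.measurable
  refine ⟨fun t => f (Set.projIcc 0 1 zero_le_one t), hf.comp hm, ?_⟩
  have h1 : unitMeasure = (volume : Measure unitInterval).map Subtype.val := by
    exact (map_comap_subtype_coe measurableSet_Icc volume).symm
  change unitMeasure.map (f ∘ Set.projIcc 0 1 zero_le_one) = _
  rw [h1, Measure.map_map (hf.comp hm) measurable_subtype_coe, ← hfm]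
  congr 1
  funext t
  simp

/-- The signed binomial weights annihilate polynomials of low degree. -/
theorem sum_even_choose_eq_sum_odd_choose (n : ℕ) (a b : ℝ) :
    ∑ j ∈ Finset.range (n + 2), (if Even j then ((n + 1).choose j : ℝ) else 0) * (a + b * j) ^ n =
    ∑ j ∈ Finset.range (n + 2), (if Even j then 0 else ((n + 1).choose j : ℝ)) * (a + b * j) ^ n := by
  -- The difference of the two sides is, up to sign, the `(n + 1)`-st forward difference at `0` of a
  -- polynomial of degree at most `n`.
  have hdeg : ((Polynomial.C a + Polynomial.C b * Polynomial.X) ^ n : Polynomial ℝ).natDegree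
      < n + 1 := by
    refine Nat.lt_succ_of_le ?_
    refine (Polynomial.natDegree_pow_le).trans ?_
    have : (Polynomial.C a + Polynomial.C b * Polynomial.X : Polynomial ℝ).natDegree ≤ 1 := by
      compute_degree
    nlinarith
  have h := congrFun (Polynomial.fwdDiff_iter_eq_zero_of_degree_lt hdeg) 0
  rw [fwdDiff_iter_eq_sum_shift] at h
  simp only [zsmul_eq_mul, Pi.zero_apply] at h
  rw [← sub_eq_zero, ← Finset.sum_sub_distrib]
  have h2 : ((-1 : ℝ) ^ (n + 1)) * ∑ j ∈ Finset.range (n + 2),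
      ((-1 : ℝ) ^ (n + 1 - j) * ((n + 1).choose j)) * (a + b * j) ^ n = 0 := by
    rw [mul_eq_zero]; right
    rw [← h]
    refine Finset.sum_congr rfl fun j _ => ?_
    simp
  refine Eq.trans ?_ h2
  rw [Finset.mul_sum]
  clear h h2
  refine Finset.sum_congr rfl fun j hj => ?_
  have hj' : j ≤ n + 1 := Nat.lt_succ_iff.1 (Finset.mem_range.1 hj)
  have : (-1 : ℝ) ^ (n + 1) * (-1) ^ (n + 1 - j) = (-1) ^ j := by
    obtain ⟨k, hk⟩ := Nat.exists_eq_add_of_le hj'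
    rw [hk, Nat.add_sub_cancel_left, pow_add, mul_assoc, ← mul_pow]
    simp
  rw [← mul_assoc, ← mul_assoc, this]
  by_cases hev : Even j
  · simp [hev]
  · simp [hev, (Nat.not_even_iff_odd.1 hev).neg_one_pow]

/-- Integration against a finitely supported law. -/
theorem integral_comp_of_map_eq_sum_dirac {s : Finset ℕ} {w : ℕ → ℝ} (hw : ∀ j, 0 ≤ w j)
    {h : ℝ → ℝ} (hm : Measurable h)
    (hlaw : unitMeasure.map h = ∑ j ∈ s, ENNReal.ofReal (w j) • Measure.dirac (j : ℝ))
    {F : ℝ → ℝ} (hF : Measurable F) :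
    ∫ t, F (h t) ∂unitMeasure = ∑ j ∈ s, w j * F j := by
  rw [← integral_map hm.aemeasurable hF.aestronglyMeasurable, hlaw, integral_finsetSum_measure]
  · refine Finset.sum_congr rfl fun j _ => ?_
    rw [integral_smul_measure, integral_dirac, ENNReal.toReal_ofReal (hw j), smul_eq_mul]
  · intro j _
    exact (integrable_dirac (by simp)).smul_measure ENNReal.ofReal_ne_top

/-- Two bounded functions on `[0,1]` with the same moments up to order `n`, the first vanishing on
a set of positive measure and the second bounded below by `1`. -/
theorem exists_equal_moments (n : ℕ) : ∃ (h k : ℝ → ℝ) (C : ℝ), Measurable h ∧ Measurable k ∧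
    (∀ᵐ t ∂unitMeasure, 0 ≤ h t ∧ h t ≤ C) ∧ (∀ᵐ t ∂unitMeasure, 1 ≤ k t ∧ k t ≤ C) ∧
    unitMeasure {t | h t = 0} ≠ 0 ∧
    ∀ a b : ℝ, ∫ t, (a + b * h t) ^ n ∂unitMeasure = ∫ t, (a + b * k t) ^ n ∂unitMeasure := by
  set s := Finset.range (n + 2) with hs
  -- `h` gets the even atoms, among them `0`; `k` gets the odd ones, all at least `1`.
  set e : ℕ → ℝ := fun j => if Even j then ((n + 1).choose j : ℝ) else 0 with he
  set o : ℕ → ℝ := fun j => if Even j then 0 else ((n + 1).choose j : ℝ) with ho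
  have he0 : ∀ j, 0 ≤ e j := fun j => by simp only [he]; split_ifs <;> positivity
  have ho0 : ∀ j, 0 ≤ o j := fun j => by simp only [ho]; split_ifs <;> positivity
  set Z := ∑ j ∈ s, e j with hZ
  have hZo : ∑ j ∈ s, o j = Z := by
    -- The constant polynomial `1` shows that both weights have the same total mass.
    have := sum_even_choose_eq_sum_odd_choose n 1 0
    simpa using this.symm
  have hZ1 : 0 < Z := by
    refine Finset.sum_pos' (fun j _ => he0 j) ⟨0, by simp [hs], by simp [he]⟩
  have hsum : ∀ c : ℕ → ℝ, (∀ j, 0 ≤ c j) → ∑ j ∈ s, c j = Z →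
      ∑ j ∈ s, ENNReal.ofReal (c j / Z) = 1 := by
    intro c hc hcZ
    rw [← ENNReal.ofReal_sum_of_nonneg fun j _ => div_nonneg (hc j) hZ1.le, ← Finset.sum_div, hcZ,
      div_self hZ1.ne', ENNReal.ofReal_one]
  obtain ⟨h, hh, hhl⟩ := exists_measurable_map_unitMeasure_eq s _ (hsum e he0 rfl)
  obtain ⟨k, hk, hkl⟩ := exists_measurable_map_unitMeasure_eq s _ (hsum o ho0 hZo)
  refine ⟨h, k, n + 1, hh, hk, ?_, ?_, ?_, ?_⟩
  · have : ∀ᵐ r ∂(unitMeasure.map h), r ∈ Set.Icc (0 : ℝ) (n + 1) := by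
      rw [hhl, ae_iff]
      simp only [Measure.coe_finsetSum, Finset.sum_apply, Finset.sum_eq_zero_iff]
      intro j hj
      have hj' : (j : ℝ) ≤ n + 1 := by
        have := Finset.mem_range.1 hj
        exact_mod_cast (by lia : j ≤ n + 1)
      simp [hj']
    exact ae_of_ae_map hh.aemeasurable this
  · have : ∀ᵐ r ∂(unitMeasure.map k), r ∈ Set.Icc (1 : ℝ) (n + 1) := by
      rw [hkl, ae_iff]
      simp only [Measure.coe_finsetSum, Finset.sum_apply, Finset.sum_eq_zero_iff]
      intro j hj
      have hj' : (j : ℝ) ≤ n + 1 := by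
        have := Finset.mem_range.1 hj
        exact_mod_cast (by lia : j ≤ n + 1)
      rcases Nat.eq_zero_or_pos j with rfl | hpos
      · simp [ho]
      · have : (1 : ℝ) ≤ j := by exact_mod_cast hpos
        simp [hj', this]
    exact ae_of_ae_map hk.aemeasurable this
  · have h0 : unitMeasure {t | h t = 0} = unitMeasure.map h {0} :=
      (Measure.map_apply hh (measurableSet_singleton 0)).symm
    rw [h0, hhl]
    simp only [Measure.coe_finsetSum, Finset.sum_apply]
    intro h1
    have := Finset.sum_eq_zero_iff.1 h1 0 (by simp [hs])
    simp [he] at this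
    linarith
  · intro a b
    have hF : Measurable fun r : ℝ => (a + b * r) ^ n := by fun_prop
    rw [integral_comp_of_map_eq_sum_dirac (fun j => div_nonneg (he0 j) hZ1.le) hh hhl hF,
      integral_comp_of_map_eq_sum_dirac (fun j => div_nonneg (ho0 j) hZ1.le) hk hkl hF]
    simp only [div_mul_eq_mul_div, ← Finset.sum_div]
    rw [sum_even_choose_eq_sum_odd_choose n a b]

/-! ### Additivity of the norm and disjointness of supports. -/

section Norms

variable {α : Type*} [MeasurableSpace α] {μ : Measure α}

/-- The norm of `L_p` as an integral. -/
theorem Lp_norm_rpow_eq_integral {F : Type*} [NormedAddCommGroup F] {p : ℝ≥0∞} [Fact (1 ≤ p)]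
    (hp : p ≠ ∞) (f : Lp F p μ) : ‖f‖ ^ p.toReal = ∫ t, ‖f t‖ ^ p.toReal ∂μ := by
  have hp0 : p ≠ 0 := (zero_lt_one.trans_le (Fact.out : 1 ≤ p)).ne'
  have hP : 0 < p.toReal := ENNReal.toReal_pos hp0 hp
  have hi : 0 ≤ ∫ t, ‖f t‖ ^ p.toReal ∂μ := integral_nonneg fun t => by positivity
  rw [Lp.norm_def, (Lp.memLp f).eLpNorm_eq_integral_rpow_norm hp0 hp,
    ENNReal.toReal_ofReal (by positivity), ← Real.rpow_mul hi, inv_mul_cancel₀ hP.ne',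
    Real.rpow_one]

theorem Lp_integrable_norm_rpow {F : Type*} [NormedAddCommGroup F] {p : ℝ≥0∞} [Fact (1 ≤ p)]
    (hp : p ≠ ∞) (f : Lp F p μ) : Integrable (fun t => ‖f t‖ ^ p.toReal) μ :=
  (Lp.memLp f).integrable_norm_rpow (zero_lt_one.trans_le (Fact.out : 1 ≤ p)).ne' hp

/-- The norm of `L_p` is `p`-additive on elements with disjoint supports. -/
theorem Lp_norm_add_rpow_of_disjoint {F : Type*} [NormedAddCommGroup F] {p : ℝ≥0∞} [Fact (1 ≤ p)]
    (hp : p ≠ ∞) {u v : Lp F p μ} (h : ∀ᵐ t ∂μ, u t = 0 ∨ v t = 0) :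
    ‖u + v‖ ^ p.toReal = ‖u‖ ^ p.toReal + ‖v‖ ^ p.toReal := by
  have hp0 : p ≠ 0 := (zero_lt_one.trans_le (Fact.out : 1 ≤ p)).ne'
  have hP : p.toReal ≠ 0 := (ENNReal.toReal_pos hp0 hp).ne'
  simp only [Lp_norm_rpow_eq_integral hp]
  rw [← integral_add (Lp_integrable_norm_rpow hp u) (Lp_integrable_norm_rpow hp v)]
  refine integral_congr_ae ?_
  filter_upwards [h, Lp.coeFn_add u v] with t ht hadd
  rw [hadd, Pi.add_apply]
  rcases ht with ht | ht <;> simp [ht, Real.zero_rpow hP]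

theorem Lp_ae_eq_zero_or_of_inf_eq_zero {p : ℝ≥0∞} {u v : Lp ℝ p μ} (h : u ⊓ v = 0) :
    ∀ᵐ t ∂μ, u t = 0 ∨ v t = 0 := by
  have h0 := Lp.coeFn_inf u v
  rw [h] at h0
  filter_upwards [h0, Lp.coeFn_zero ℝ p μ] with t ht hz
  rw [hz] at ht
  simp only [Pi.zero_apply, Pi.inf_apply] at ht
  rcases min_choice (u t) (v t) with h1 | h1 <;> rw [h1] at ht <;> simp [ht.symm]

/-- Strictness is what lets the norm detect fibres where two disjoint elements are both nonzero. -/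
theorem pow_add_pow_lt_add_pow {n : ℕ} (hn : 2 ≤ n) {a b : ℝ} (ha : 0 < a) (hb : 0 < b) :
    a ^ n + b ^ n < (a + b) ^ n := by
  obtain ⟨m, rfl⟩ := Nat.exists_eq_add_of_le' hn
  have h1 : a ^ (m + 1) < (a + b) ^ (m + 1) :=
    pow_lt_pow_left₀ (by linarith) ha.le (by lia)
  have h2 : b ^ (m + 1) < (a + b) ^ (m + 1) :=
    pow_lt_pow_left₀ (by linarith) hb.le (by lia)
  calc a ^ (m + 2) + b ^ (m + 2) = a ^ (m + 1) * a + b ^ (m + 1) * b := by ring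
    _ < (a + b) ^ (m + 1) * a + (a + b) ^ (m + 1) * b := by gcongr
    _ = (a + b) ^ (m + 2) := by ring

theorem pow_add_pow_le_add_pow_of_nonneg {n : ℕ} (hn : 2 ≤ n) {a b : ℝ} (ha : 0 ≤ a) (hb : 0 ≤ b) :
    a ^ n + b ^ n ≤ (a + b) ^ n := by
  have hn0 : n ≠ 0 := by lia
  rcases ha.eq_or_lt with rfl | ha
  · simp [hn0]
  rcases hb.eq_or_lt with rfl | hb
  · simp [hn0]
  exact (pow_add_pow_lt_add_pow hn ha hb).le

/-- Disjoint elements of `L_p(L_q)`, `p / q ∈ {2, 3, …}`, on which the norm is `p`-additive have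
disjoint supports in the outer variable. -/
theorem Lp_Lp_ae_eq_zero_or_of_norm_add_rpow {β : Type*} [MeasurableSpace β] {ν : Measure β}
    {p q : ℝ≥0∞} [Fact (1 ≤ p)] [Fact (1 ≤ q)] (hp : p ≠ ∞) (hq : q ≠ ∞) {n : ℕ} (hn : 2 ≤ n)
    (hpq : p.toReal = q.toReal * n) {u v : Lp (Lp ℝ q ν) p μ} (hinf : u ⊓ v = 0)
    (hadd : ‖u + v‖ ^ p.toReal = ‖u‖ ^ p.toReal + ‖v‖ ^ p.toReal) :
    ∀ᵐ s ∂μ, u s = 0 ∨ v s = 0 := by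
  have hq0 : q ≠ 0 := (zero_lt_one.trans_le (Fact.out : 1 ≤ q)).ne'
  have hfib : ∀ᵐ s ∂μ, ‖(u + v) s‖ ^ p.toReal =
      (‖u s‖ ^ q.toReal + ‖v s‖ ^ q.toReal) ^ n := by
    have h0 := Lp.coeFn_inf u v
    rw [hinf] at h0
    filter_upwards [h0, Lp.coeFn_zero (Lp ℝ q ν) p μ, Lp.coeFn_add u v] with s hs hz hs2
    rw [hz] at hs
    rw [hs2, Pi.add_apply, hpq, Real.rpow_mul (norm_nonneg _), Real.rpow_natCast,
      Lp_norm_add_rpow_of_disjoint hq (Lp_ae_eq_zero_or_of_inf_eq_zero hs.symm)]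
  have hpow : ∀ w : Lp ℝ q ν, ‖w‖ ^ p.toReal = (‖w‖ ^ q.toReal) ^ n := fun w => by
    rw [hpq, Real.rpow_mul (norm_nonneg _), Real.rpow_natCast]
  simp only [Lp_norm_rpow_eq_integral hp] at hadd
  rw [← integral_add (Lp_integrable_norm_rpow hp u) (Lp_integrable_norm_rpow hp v)] at hadd
  have hle : (fun s => ‖u s‖ ^ p.toReal + ‖v s‖ ^ p.toReal) ≤ᵐ[μ]
      fun s => ‖(u + v) s‖ ^ p.toReal := by
    filter_upwards [hfib] with s hs
    rw [hs, hpow, hpow]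
    exact pow_add_pow_le_add_pow_of_nonneg hn (by positivity) (by positivity)
  -- A pointwise inequality whose integrals agree is an equality almost everywhere.
  have heq := (integral_eq_iff_of_ae_le ((Lp_integrable_norm_rpow hp u).add
    (Lp_integrable_norm_rpow hp v)) (Lp_integrable_norm_rpow hp (u + v)) hle).1 hadd.symm
  filter_upwards [hfib, heq] with s hs hs2
  rw [hs, Pi.add_apply, hpow, hpow] at hs2
  by_contra! hne
  exact (pow_add_pow_lt_add_pow hn (Real.rpow_pos_of_pos (norm_pos_iff.2 hne.1) q.toReal)
    (Real.rpow_pos_of_pos (norm_pos_iff.2 hne.2) q.toReal)).ne hs2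

end Norms

/-- The lattice operations on the span of two disjoint positive elements of `L_q`. -/
theorem Lp_sup_inf_of_disjoint {α : Type*} [MeasurableSpace α] {μ : Measure α} {q : ℝ≥0∞}
    {w₁ w₂ : Lp ℝ q μ} (h₁ : 0 ≤ w₁) (h₂ : 0 ≤ w₂) (hd : ∀ᵐ t ∂μ, w₁ t = 0 ∨ w₂ t = 0)
    (a b c d : ℝ) :
    (a • w₁ + b • w₂) ⊔ (c • w₁ + d • w₂) = (a ⊔ c) • w₁ + (b ⊔ d) • w₂ ∧
    (a • w₁ + b • w₂) ⊓ (c • w₁ + d • w₂) = (a ⊓ c) • w₁ + (b ⊓ d) • w₂ := by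
  have hcoe : ∀ a b : ℝ, ∀ᵐ t ∂μ, (a • w₁ + b • w₂ : Lp ℝ q μ) t = a * w₁ t + b * w₂ t := by
    intro a b
    filter_upwards [Lp.coeFn_add (a • w₁) (b • w₂), Lp.coeFn_smul a w₁, Lp.coeFn_smul b w₂]
      with t e1 e2 e3
    rw [e1, Pi.add_apply, e2, e3]
    rfl
  rw [← Lp.coeFn_nonneg] at h₁ h₂
  constructor
  · refine Lp.ext ?_
    filter_upwards [hcoe a b, hcoe c d, hcoe (a ⊔ c) (b ⊔ d), hd, h₁, h₂,
      Lp.coeFn_sup (a • w₁ + b • w₂) (c • w₁ + d • w₂)] with t e1 e2 e3 e4 p1 p2 e5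
    rw [e5, Pi.sup_apply, e1, e2, e3]
    simp only [Pi.zero_apply] at p1 p2
    rcases e4 with e4 | e4 <;> simp [e4, max_mul_of_nonneg, p1, p2]
  · refine Lp.ext ?_
    filter_upwards [hcoe a b, hcoe c d, hcoe (a ⊓ c) (b ⊓ d), hd, h₁, h₂,
      Lp.coeFn_inf (a • w₁ + b • w₂) (c • w₁ + d • w₂)] with t e1 e2 e3 e4 p1 p2 e5
    rw [e5, Pi.inf_apply, e1, e2, e3]
    simp only [Pi.zero_apply] at p1 p2
    rcases e4 with e4 | e4 <;> simp [e4, min_mul_of_nonneg, p1, p2]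

/-- `L_q[0,1]` contains two disjoint positive unit vectors. -/
theorem exists_disjoint_unit_vectors {q : ℝ≥0∞} [Fact (1 ≤ q)] (hq : q ≠ ∞) :
    ∃ w₁ w₂ : Lp ℝ q unitMeasure, 0 ≤ w₁ ∧ 0 ≤ w₂ ∧ ‖w₁‖ = 1 ∧ ‖w₂‖ = 1 ∧
      ∀ᵐ t ∂unitMeasure, w₁ t = 0 ∨ w₂ t = 0 := by
  have hq0 : q ≠ 0 := (zero_lt_one.trans_le (Fact.out : 1 ≤ q)).ne'
  have key : ∀ a b : ℝ, 0 ≤ a → a < b → b ≤ 1 → ∃ w : Lp ℝ q unitMeasure, 0 ≤ w ∧ ‖w‖ = 1 ∧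
      ∀ᵐ t ∂unitMeasure, t ∉ Set.Ioc a b → w t = 0 := by
    intro a b ha hab hb
    have hv : unitMeasure (Set.Ioc a b) = ENNReal.ofReal (b - a) := by
      rw [Measure.restrict_apply measurableSet_Ioc, Set.inter_eq_left.2, Real.volume_Ioc]
      exact fun t ht => ⟨ha.trans ht.1.le, ht.2.trans hb⟩
    have hpos : 0 < unitMeasure.real (Set.Ioc a b) := by
      rw [measureReal_def, hv, ENNReal.toReal_ofReal (by linarith)]
      linarith
    set c : ℝ := (unitMeasure.real (Set.Ioc a b) ^ (1 / q.toReal))⁻¹ with hc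
    have hcpos : 0 < c := by positivity
    refine ⟨indicatorConstLp q measurableSet_Ioc (measure_ne_top unitMeasure (Set.Ioc a b)) c,
      ?_, ?_, indicatorConstLp_coeFn_notMem⟩
    · rw [← Lp.coeFn_nonneg]
      filter_upwards [indicatorConstLp_coeFn (p := q) (hs := measurableSet_Ioc)
        (hμs := measure_ne_top unitMeasure (Set.Ioc a b)) (c := c)] with t ht
      rw [ht]
      exact Set.indicator_nonneg (fun _ _ => hcpos.le) t
    · rw [norm_indicatorConstLp hq0 hq, Real.norm_of_nonneg hcpos.le, hc]
      exact inv_mul_cancel₀ (by positivity)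
  obtain ⟨w₁, h1, h2, h3⟩ := key 0 (1 / 2) le_rfl (by norm_num) (by norm_num)
  obtain ⟨w₂, k1, k2, k3⟩ := key (1 / 2) 1 (by norm_num) (by norm_num) le_rfl
  refine ⟨w₁, w₂, h1, k1, h2, k2, ?_⟩
  filter_upwards [h3, k3] with t e1 e2
  by_cases ht : t ≤ 1 / 2
  · exact Or.inr (e2 fun h => absurd h.1 (not_lt.2 ht))
  · exact Or.inl (e1 fun h => ht h.2)

/-! ### Planes spanned by `1 ⊗ w₁` and `g ⊗ w₂`. -/

section PlaneEmbedding

variable {α : Type*} [MeasurableSpace α] {μ : Measure α} {p : ℝ≥0∞}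

/-- The linear map `ℝ² → X` sending the standard basis to `x` and `y`. -/
def planeMap {X : Type*} [AddCommGroup X] [Module ℝ X] (x y : X) : ℝ × ℝ →ₗ[ℝ] X :=
  (LinearMap.fst ℝ ℝ ℝ).smulRight x + (LinearMap.snd ℝ ℝ ℝ).smulRight y

theorem planeMap_apply {X : Type*} [AddCommGroup X] [Module ℝ X] (x y : X) (z : ℝ × ℝ) :
    planeMap x y z = z.1 • x + z.2 • y := rfl

theorem planeMap_coeFn {F : Type*} [NormedAddCommGroup F] [NormedSpace ℝ F] {w₁ w₂ : F}
    {g : α → ℝ} {x y : Lp F p μ} (hx : ∀ᵐ s ∂μ, x s = w₁) (hy : ∀ᵐ s ∂μ, y s = g s • w₂)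
    (z : ℝ × ℝ) : ∀ᵐ s ∂μ, planeMap x y z s = z.1 • w₁ + (z.2 * g s) • w₂ := by
  filter_upwards [hx, hy, Lp.coeFn_add (z.1 • x) (z.2 • y), Lp.coeFn_smul z.1 x,
    Lp.coeFn_smul z.2 y] with s e1 e2 e3 e4 e5
  rw [planeMap_apply, e3, Pi.add_apply, e4, e5, Pi.smul_apply, Pi.smul_apply, e1, e2, smul_smul]

theorem planeMap_sup_inf {β : Type*} [MeasurableSpace β] {ν : Measure β} {q : ℝ≥0∞}
    [Fact (1 ≤ q)] {w₁ w₂ : Lp ℝ q ν} (h₁ : 0 ≤ w₁) (h₂ : 0 ≤ w₂)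
    (hd : ∀ᵐ t ∂ν, w₁ t = 0 ∨ w₂ t = 0) {g : α → ℝ} (hg : ∀ᵐ s ∂μ, 0 ≤ g s)
    {x y : Lp (Lp ℝ q ν) p μ} (hx : ∀ᵐ s ∂μ, x s = w₁) (hy : ∀ᵐ s ∂μ, y s = g s • w₂) :
    PreservesLattice (planeMap x y) := by
  intro z z'
  constructor
  · refine Lp.ext ?_
    filter_upwards [planeMap_coeFn hx hy z, planeMap_coeFn hx hy z', planeMap_coeFn hx hy (z ⊔ z'),
      Lp.coeFn_sup (planeMap x y z) (planeMap x y z'), hg] with s e1 e2 e3 e4 hs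
    rw [e4, Pi.sup_apply, e1, e2, e3, (Lp_sup_inf_of_disjoint h₁ h₂ hd _ _ _ _).1,
      Prod.fst_sup, Prod.snd_sup, max_mul_of_nonneg _ _ hs]
  · refine Lp.ext ?_
    filter_upwards [planeMap_coeFn hx hy z, planeMap_coeFn hx hy z', planeMap_coeFn hx hy (z ⊓ z'),
      Lp.coeFn_inf (planeMap x y z) (planeMap x y z'), hg] with s e1 e2 e3 e4 hs
    rw [e4, Pi.inf_apply, e1, e2, e3, (Lp_sup_inf_of_disjoint h₁ h₂ hd _ _ _ _).2,
      Prod.fst_inf, Prod.snd_inf, min_mul_of_nonneg _ _ hs]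

theorem Lp_norm_smul_add_smul_rpow {β : Type*} [MeasurableSpace β] {ν : Measure β} {q : ℝ≥0∞}
    [Fact (1 ≤ q)] (hq : q ≠ ∞) {w₁ w₂ : Lp ℝ q ν} (h₁ : ‖w₁‖ = 1) (h₂ : ‖w₂‖ = 1)
    (hd : ∀ᵐ t ∂ν, w₁ t = 0 ∨ w₂ t = 0) (a b : ℝ) :
    ‖a • w₁ + b • w₂‖ ^ q.toReal = |a| ^ q.toReal + |b| ^ q.toReal := by
  rw [Lp_norm_add_rpow_of_disjoint hq]
  · simp [norm_smul, h₁, h₂]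
  · filter_upwards [hd, Lp.coeFn_smul a w₁, Lp.coeFn_smul b w₂] with t ht e1 e2
    rw [e1, e2, Pi.smul_apply, Pi.smul_apply]
    rcases ht with ht | ht <;> simp [ht]

/-- The exponent `1/q` cancels against the fibre norm. As `p / q = n` is an integer, the integrand
is a polynomial in `h`, so moments determine the norm. -/
theorem planeMap_norm_rpow [Fact (1 ≤ p)] (hp : p ≠ ∞) {β : Type*} [MeasurableSpace β]
    {ν : Measure β} {q : ℝ≥0∞} [Fact (1 ≤ q)] (hq : q ≠ ∞) {n : ℕ}
    (hpq : p.toReal = q.toReal * n) {w₁ w₂ : Lp ℝ q ν} (h₁ : ‖w₁‖ = 1) (h₂ : ‖w₂‖ = 1)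
    (hd : ∀ᵐ t ∂ν, w₁ t = 0 ∨ w₂ t = 0) {h : α → ℝ} (hh : ∀ᵐ s ∂μ, 0 ≤ h s)
    {x y : Lp (Lp ℝ q ν) p μ} (hx : ∀ᵐ s ∂μ, x s = w₁)
    (hy : ∀ᵐ s ∂μ, y s = (h s ^ q.toReal⁻¹) • w₂) (z : ℝ × ℝ) :
    ‖planeMap x y z‖ ^ p.toReal =
      ∫ s, (|z.1| ^ q.toReal + |z.2| ^ q.toReal * h s) ^ n ∂μ := by
  have hq0 : q.toReal ≠ 0 :=
    (ENNReal.toReal_pos (zero_lt_one.trans_le (Fact.out : 1 ≤ q)).ne' hq).ne'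
  rw [Lp_norm_rpow_eq_integral hp]
  refine integral_congr_ae ?_
  filter_upwards [planeMap_coeFn hx hy z, hh] with s e1 hs
  rw [e1, hpq, Real.rpow_mul (norm_nonneg _), Real.rpow_natCast,
    Lp_norm_smul_add_smul_rpow hq h₁ h₂ hd, abs_mul, abs_of_nonneg (Real.rpow_nonneg hs _),
    Real.mul_rpow (abs_nonneg _) (Real.rpow_nonneg hs _), Real.rpow_inv_rpow hs hq0]

end PlaneEmbedding

/-! ### Rigidity of lattice isometries. -/

/-- If a lattice isometry `φ` of `L_p(L_q)` maps `x` and `y` near `x'` and `y'`, and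
`‖x'(s)‖ ≤ ‖y'(s)‖` everywhere, then `x` cannot have a large component `c` supported where `y`
vanishes. -/
theorem norm_le_of_preservesLattice {p q : ℝ≥0∞} [Fact (1 ≤ p)] [Fact (1 ≤ q)] (hp : p ≠ ∞)
    (hq : q ≠ ∞) {n : ℕ} (hn : 2 ≤ n) (hpq : p.toReal = q.toReal * n)
    (φ : LpLq p q →ₗᵢ[ℝ] LpLq p q) (hφ : PreservesLattice φ) {x y x' y' c : LpLq p q}
    (hc : 0 ≤ c) (hcx : c ≤ x) (hy : 0 ≤ y) (hcy : ∀ᵐ s ∂unitMeasure, c s = 0 ∨ y s = 0)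
    (hxy' : ∀ᵐ s ∂unitMeasure, ‖x' s‖ ≤ ‖y' s‖) :
    ‖c‖ ≤ ‖φ y - y'‖ + ‖φ x - x'‖ := by
  have hmono : ∀ {a b : LpLq p q}, a ≤ b → φ a ≤ φ b := fun {a b} hab => by
    have := (hφ a b).1
    rw [sup_eq_right.2 hab] at this
    exact sup_eq_right.1 this.symm
  have hinf : c ⊓ y = 0 := by
    refine Lp.ext ?_
    rw [← Lp.coeFn_nonneg] at hc hy
    filter_upwards [hcy, Lp.coeFn_inf c y, Lp.coeFn_zero (Lp ℝ q unitMeasure) p unitMeasure, hc, hy]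
      with s h1 h2 h3 h4 h5
    rw [h2, h3, Pi.inf_apply]
    simp only [Pi.zero_apply] at h4 h5 ⊢
    rcases h1 with h1 | h1
    · rw [h1, inf_eq_left.2 h5]
    · rw [h1, inf_eq_right.2 h4]
  have hdisj : ∀ᵐ s ∂unitMeasure, φ c s = 0 ∨ φ y s = 0 := by
    refine Lp_Lp_ae_eq_zero_or_of_norm_add_rpow hp hq hn hpq ?_ ?_
    · rw [← (hφ c y).2, hinf, map_zero]
    · rw [← map_add, φ.norm_map, φ.norm_map, φ.norm_map, Lp_norm_add_rpow_of_disjoint hp hcy]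
  have hc' : 0 ≤ φ c := by simpa using hmono hc
  have hcx' : φ c ≤ φ x := hmono hcx
  have hbound : ∀ᵐ s ∂unitMeasure, ‖φ c s‖ ≤ ‖(φ y - y') s‖ + ‖(φ x - x') s‖ := by
    rw [← Lp.coeFn_nonneg] at hc'
    rw [← Lp.coeFn_le] at hcx'
    filter_upwards [hdisj, hc', hcx', hxy', Lp.coeFn_sub (φ y) y', Lp.coeFn_sub (φ x) x']
      with s h1 h2 h3 h4 h5 h6
    rw [h5, h6, Pi.sub_apply, Pi.sub_apply]
    -- Where `φ y` vanishes, `‖y' s‖` is itself the error `‖(φ y - y') s‖`, and it bounds `‖x' s‖`.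
    rcases h1 with h1 | h1
    · rw [h1, norm_zero]
      positivity
    · have h7 : ‖φ c s‖ ≤ ‖φ x s‖ := by
        refine norm_le_norm_of_abs_le_abs ?_
        rwa [abs_of_nonneg h2, abs_of_nonneg (h2.trans h3)]
      have h8 : ‖φ x s‖ ≤ ‖φ x s - x' s‖ + ‖x' s‖ := by
        simpa using norm_add_le (φ x s - x' s) (x' s)
      rw [h1, zero_sub, norm_neg]
      linarith
  rw [← φ.norm_map c]
  -- Passing to the scalar functions of fibre norms turns the pointwise bound into the triangle
  -- inequality of `L_p`.
  set F := (Lp.memLp (φ y - y')).norm.toLp _ with hF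
  set G := (Lp.memLp (φ x - x')).norm.toLp _ with hG
  have hFn : ‖F‖ = ‖φ y - y'‖ := by rw [hF, Lp.norm_toLp, eLpNorm_norm, Lp.norm_def]
  have hGn : ‖G‖ = ‖φ x - x'‖ := by rw [hG, Lp.norm_toLp, eLpNorm_norm, Lp.norm_def]
  rw [← hFn, ← hGn]
  refine le_trans (Lp.norm_le_norm_of_ae_le ?_) (norm_add_le F G)
  filter_upwards [hbound, Lp.coeFn_add F G, MemLp.coeFn_toLp (Lp.memLp (φ y - y')).norm,
    MemLp.coeFn_toLp (Lp.memLp (φ x - x')).norm] with s h1 h2 h3 h4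
  rw [h2, Pi.add_apply, h3, h4]
  exact h1.trans (le_abs_self _)

/-! ### Homogeneity applied to planes, and the contradiction. -/

/-- A linear map on `ℝ²` that preserves the lattice operations has a vector sublattice as range. -/
def rangeSublattice {X : Type*} [NormedAddCommGroup X] [Lattice X] [NormedSpace ℝ X]
    (T : ℝ × ℝ →ₗ[ℝ] X) (hT : PreservesLattice T) : VectorSublattice X where
  toSubmodule := LinearMap.range T
  sup_mem' := by
    rintro _ _ ⟨z, rfl⟩ ⟨z', rfl⟩
    exact ⟨z ⊔ z', (hT z z').1⟩
  inf_mem' := by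
    rintro _ _ ⟨z, rfl⟩ ⟨z', rfl⟩
    exact ⟨z ⊓ z', (hT z z').2⟩

/-- In an approximately ultrahomogeneous lattice, two lattice embeddings of the same normed
sublattice of dimension two are almost conjugate. -/
theorem IsAUHOver.exists_of_planeMap {X : Type*} [NormedAddCommGroup X] [Lattice X]
    [NormedSpace ℝ X]
    (hX : IsAUHOver X {E : VectorSublattice X | FiniteDimensional ℝ E.toSubmodule})
    {x y x' y' : X} (hT : PreservesLattice (planeMap x y)) (hT' : PreservesLattice (planeMap x' y'))
    (hinj : Function.Injective (planeMap x y))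
    (hnorm : ∀ z, ‖planeMap x y z‖ = ‖planeMap x' y' z‖) {ε : ℝ} (hε : 0 < ε) :
    ∃ φ : X ≃ₗᵢ[ℝ] X, PreservesLattice φ ∧ ‖φ x - x'‖ < ε ∧ ‖φ y - y'‖ < ε := by
  let E := rangeSublattice (planeMap x y) hT
  let i : (ℝ × ℝ) ≃ₗ[ℝ] E.toSubmodule := LinearEquiv.ofInjective (planeMap x y) hinj
  have hi : ∀ z, (i z : X) = planeMap x y z := fun z => rfl
  have hsymm : ∀ v : E.toSubmodule, planeMap x y (i.symm v) = v := fun v => by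
    rw [← hi, i.apply_symm_apply]
  have hfin : FiniteDimensional ℝ E.toSubmodule := i.finiteDimensional
  let f₁ : E.toSubmodule →ₗᵢ[ℝ] X := E.toSubmodule.subtypeₗᵢ
  let f₂ : E.toSubmodule →ₗᵢ[ℝ] X :=
    { toLinearMap := planeMap x' y' ∘ₗ i.symm.toLinearMap
      norm_map' := fun v => by
        change ‖planeMap x' y' (i.symm v)‖ = ‖v‖
        rw [← hnorm, hsymm]
        rfl }
  have hf₂ : ∀ z, f₂ (i z) = planeMap x' y' z := fun z => by
    change planeMap x' y' (i.symm (i z)) = _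
    rw [i.symm_apply_apply]
  have hisup : ∀ z z', i z ⊔ i z' = i (z ⊔ z') := fun z z' => Subtype.ext (hT z z').1.symm
  have hiinf : ∀ z z', i z ⊓ i z' = i (z ⊓ z') := fun z z' => Subtype.ext (hT z z').2.symm
  have hf₂l : PreservesLattice f₂ := by
    intro v v'
    obtain ⟨z, rfl⟩ := i.surjective v
    obtain ⟨z', rfl⟩ := i.surjective v'
    rw [hisup, hiinf, hf₂, hf₂, hf₂, hf₂]
    exact hT' z z'
  have hgen : E.IsGeneratedBy ![i (1, 0), i (0, 1)] := by
    refine ⟨Submodule.closed_of_finiteDimensional E.toSubmodule, fun F _ hF v hv => ?_⟩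
    obtain ⟨z, rfl⟩ := hv
    have h0 := hF 0
    have h1 := hF 1
    simp only [Matrix.cons_val_zero, Matrix.cons_val_one, hi, planeMap_apply, one_smul, zero_smul,
      add_zero, zero_add] at h0 h1
    exact F.toSubmodule.add_mem (F.toSubmodule.smul_mem _ h0) (F.toSubmodule.smul_mem _ h1)
  obtain ⟨φ, hφ, hφε⟩ := hX E hfin 2 _ hgen f₁ f₂ (fun v v' => ⟨rfl, rfl⟩) hf₂l ε hε
  refine ⟨φ, hφ, ?_, ?_⟩
  · have := hφε 0
    simp only [Matrix.cons_val_zero, hf₂] at this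
    simpa [f₁, hi, planeMap_apply] using this
  · have := hφε 1
    simp only [Matrix.cons_val_one, Matrix.cons_val_zero, hf₂] at this
    simpa [f₁, hi, planeMap_apply] using this

/-- A bounded measurable real function on `[0,1]` times a fixed vector, as an element of `L_p`. -/
theorem exists_Lp_ae_eq_smul {F : Type*} [NormedAddCommGroup F] [NormedSpace ℝ F] (p : ℝ≥0∞)
    {g : ℝ → ℝ} (hg : Measurable g) {C : ℝ} (hC : ∀ᵐ t ∂unitMeasure, ‖g t‖ ≤ C) (w : F) :
    ∃ y : Lp F p unitMeasure, ∀ᵐ t ∂unitMeasure, y t = g t • w := by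
  have : MemLp (fun t => g t • w) p unitMeasure := by
    refine MemLp.of_bound (hg.aestronglyMeasurable.smul_const w) (C * ‖w‖) ?_
    filter_upwards [hC] with t ht
    rw [norm_smul]
    gcongr
  exact ⟨this.toLp _, this.coeFn_toLp⟩

theorem theoremt (p q : ℝ≥0∞) [Fact (1 ≤ p)] [Fact (1 ≤ q)] (hp : p ≠ ∞) (hq : q ≠ ∞)
    (hpq : p ≠ q) (hn : ∃ n : ℕ, p / q = (n : ℝ≥0∞)) :
    ¬ IsAUHOver (LpLq p q)
      {E : VectorSublattice (LpLq p q) | FiniteDimensional ℝ E.toSubmodule} := by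
  intro hAUH
  obtain ⟨n, hn⟩ := hn
  have hp1 : 1 ≤ p := Fact.out
  have hq1 : 1 ≤ q := Fact.out
  have hp0 : p ≠ 0 := (zero_lt_one.trans_le hp1).ne'
  have hq0 : q ≠ 0 := (zero_lt_one.trans_le hq1).ne'
  have hpn : p = q * n := by rw [← hn, ENNReal.mul_div_cancel hq0 hq]
  have hn2 : 2 ≤ n := by
    rcases n with _ | _ | n
    · simp [hpn] at hp0
    · simp [hpn] at hpq
    · lia
  have hPQ : p.toReal = q.toReal * n := by rw [hpn, ENNReal.toReal_mul, ENNReal.toReal_natCast]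
  have hP : 0 < p.toReal := ENNReal.toReal_pos hp0 hp
  have hQ : 0 < q.toReal := ENNReal.toReal_pos hq0 hq
  obtain ⟨h, k, C, hh, hk, hhC, hkC, hA, hmom⟩ := exists_equal_moments n
  obtain ⟨w₁, w₂, hw₁, hw₂, hw₁n, hw₂n, hd⟩ := exists_disjoint_unit_vectors hq
  have hbd : ∀ r : ℝ, 0 ≤ r ∧ r ≤ C → ‖r ^ q.toReal⁻¹‖ ≤ C ^ q.toReal⁻¹ := fun r hr => by
    rw [Real.norm_of_nonneg (Real.rpow_nonneg hr.1 _)]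
    exact Real.rpow_le_rpow hr.1 hr.2 (by positivity)
  obtain ⟨x, hx⟩ := exists_Lp_ae_eq_smul p (g := fun _ => 1) measurable_const (C := 1) (by simp) w₁
  simp only [one_smul] at hx
  obtain ⟨y, hy⟩ := exists_Lp_ae_eq_smul p (hh.pow_const q.toReal⁻¹)
    (hhC.mono fun t ht => hbd _ ht) w₂
  obtain ⟨y', hy'⟩ := exists_Lp_ae_eq_smul p (hk.pow_const q.toReal⁻¹)
    (hkC.mono fun t ht => hbd _ ⟨zero_le_one.trans ht.1, ht.2⟩) w₂
  have hh0 : ∀ᵐ t ∂unitMeasure, 0 ≤ h t := hhC.mono fun t ht => ht.1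
  have hk0 : ∀ᵐ t ∂unitMeasure, 0 ≤ k t := hkC.mono fun t ht => zero_le_one.trans ht.1
  have hnorm : ∀ z, ‖planeMap x y z‖ = ‖planeMap x y' z‖ := fun z => by
    rw [← Real.rpow_left_inj (norm_nonneg _) (norm_nonneg _) hP.ne',
      planeMap_norm_rpow hp hq hPQ hw₁n hw₂n hd hh0 hx hy,
      planeMap_norm_rpow hp hq hPQ hw₁n hw₂n hd hk0 hx hy', hmom]
  have hne : (ae unitMeasure).NeBot := by
    rw [ae_neBot]
    intro h0
    exact hA (by rw [h0]; simp)
  have hinj : Function.Injective (planeMap x y) := by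
    rw [injective_iff_map_eq_zero]
    intro z hz
    -- Injectivity is read off from `y'`, since `k ≥ 1` makes any typical fibre usable.
    have hz' : planeMap x y' z = 0 := by rw [← norm_eq_zero, ← hnorm, hz, norm_zero]
    have hcoe := planeMap_coeFn hx hy' z
    rw [hz'] at hcoe
    obtain ⟨s, h1, h2, h3⟩ := (hcoe.and ((Lp.coeFn_zero (Lp ℝ q unitMeasure) p unitMeasure).and
      hkC)).exists
    rw [h2, Pi.zero_apply] at h1
    have h4 := Lp_norm_smul_add_smul_rpow hq hw₁n hw₂n hd z.1 (z.2 * k s ^ q.toReal⁻¹)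
    rw [← h1, norm_zero, Real.zero_rpow hQ.ne'] at h4
    have h5 : |z.1| ^ q.toReal = 0 := by
      have := Real.rpow_nonneg (abs_nonneg (z.2 * k s ^ q.toReal⁻¹)) q.toReal
      have := Real.rpow_nonneg (abs_nonneg z.1) q.toReal
      linarith
    rw [h5, zero_add, eq_comm, Real.rpow_eq_zero (abs_nonneg _) hQ.ne', abs_eq_zero,
      mul_eq_zero] at h4
    rw [Real.rpow_eq_zero (abs_nonneg _) hQ.ne', abs_eq_zero] at h5
    have hkpos : 0 < k s := zero_lt_one.trans_le h3.1
    exact Prod.ext h5 (h4.resolve_right (Real.rpow_pos_of_pos hkpos _).ne')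
  set A : Set ℝ := {t | h t = 0} with hAdef
  have hAm : MeasurableSet A := hh (measurableSet_singleton 0)
  have hAf : unitMeasure A ≠ ∞ := measure_ne_top _ _
  set c : LpLq p q := indicatorConstLp p hAm hAf w₁ with hc
  have hcpos : 0 < ‖c‖ := by
    rw [hc, norm_indicatorConstLp hp0 hp, hw₁n, one_mul]
    exact Real.rpow_pos_of_pos (ENNReal.toReal_pos hA hAf) _
  have hcA : ∀ᵐ s ∂unitMeasure, c s = A.indicator (fun _ => w₁) s := indicatorConstLp_coeFn
  -- With tolerance `‖c‖ / 2` the two errors add up to less than `‖c‖`.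
  obtain ⟨φ, hφ, hφx, hφy⟩ := hAUH.exists_of_planeMap
    (planeMap_sup_inf hw₁ hw₂ hd (hh0.mono fun t ht => Real.rpow_nonneg ht _) hx hy)
    (planeMap_sup_inf hw₁ hw₂ hd (hk0.mono fun t ht => Real.rpow_nonneg ht _) hx hy')
    hinj hnorm (half_pos hcpos)
  have hfinal : ‖c‖ ≤ ‖φ y - y'‖ + ‖φ x - x‖ := by
    refine norm_le_of_preservesLattice hp hq hn2 hPQ φ.toLinearIsometry hφ ?_ ?_ ?_ ?_ ?_
    · rw [← Lp.coeFn_nonneg]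
      filter_upwards [hcA] with s hs
      rw [hs]
      exact Set.indicator_nonneg (fun _ _ => hw₁) s
    · rw [← Lp.coeFn_le]
      filter_upwards [hcA, hx] with s hs hs2
      rw [hs, hs2]
      exact Set.indicator_le_self' (fun _ _ => hw₁) s
    · rw [← Lp.coeFn_nonneg]
      filter_upwards [hy, hh0] with s hs hs2
      have := (Lp_sup_inf_of_disjoint hw₁ hw₂ hd 0 (h s ^ q.toReal⁻¹) 0 0).1
      rw [sup_of_le_left (Real.rpow_nonneg hs2 _)] at this
      simp only [zero_smul, zero_add, sup_idem, sup_eq_left] at this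
      rw [hs]
      exact this
    · filter_upwards [hcA, hy] with s hs hs2
      by_cases hsA : s ∈ A
      · right
        rw [hs2, show h s = 0 from hsA, Real.zero_rpow (inv_ne_zero hQ.ne'), zero_smul]
      · left
        rw [hs, Set.indicator_of_notMem hsA]
    -- Here `k ≥ 1` is decisive: `‖x s‖ = 1 ≤ k s ^ (1/q) = ‖y' s‖`.
    · filter_upwards [hx, hy', hkC] with s hs hs2 hs3
      rw [hs, hs2, norm_smul, hw₁n, hw₂n, mul_one]
      exact (Real.one_le_rpow hs3.1 (by positivity)).trans (le_abs_self _)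
  linarith
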